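/- Let $\mathcal{D}$ be a separable C*-algebra and let $\mathcal{E}$ be a nonunital $\sigma$-unital C*-algebra, with multiplier algebra $\mathcal{M}(\mathcal{E})$ and corona algebra $\mathcal{C}(\mathcal{E}) = \mathcal{M}(\mathcal{E})/\mathcal{E}$. Let $\phi, \psi : \mathcal{D} \rightarrow \mathcal{C}(\mathcal{E})$ be extensions, i.e. arbitrary *-homomorphisms (Busby invariants, not assumed injective or unital). Then the following are equivalent: (a) $\phi$ and $\psi$ are asymptotically unitarily equivalent: there is a norm-continuous path $\{u_t\}_{t \in [1,\infty)}$ of unitaries in $\mathcal{C}(\mathcal{E})$ such that $\| u_t \phi(d) u_t^* - \psi(d) \| \rightarrow 0$ as $t \rightarrow \infty$ for every $d \in \mathcal{D}$; (b) $\phi$ and $\psi$ are weakly unitarily equivalent: there is a unitary $w \in \mathcal{C}(\mathcal{E})$ such that $w \phi(d) w^* = \psi(d)$ for every $d \in \mathcal{D}$. -/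

import Mathlib

open Filter Topology
open scoped MultiplierAlgebra

noncomputable section

namespace CStarExt

/-! ### The corona algebra `M(E) / E` -/

section Corona

variable (E : Type*) [NonUnitalCStarAlgebra E]

/-- The canonical copy of `E` inside its multiplier algebra, as a left ideal
(it is two-sided, see the instance below). -/
def canonicalIdeal : Ideal 𝓜(ℂ, E) where
  carrier := Set.range (fun a : E => (a : 𝓜(ℂ, E)))
  add_mem' := by
    rintro _ _ ⟨a, rfl⟩ ⟨b, rfl⟩
    exact ⟨a + b, map_add (DoubleCentralizer.coeHom (𝕜 := ℂ) (A := E)) a b⟩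
  zero_mem' := ⟨0, map_zero (DoubleCentralizer.coeHom (𝕜 := ℂ) (A := E))⟩
  smul_mem' := by
    rintro m _ ⟨a, rfl⟩
    refine ⟨m.fst a, DoubleCentralizer.ext _ _ _ _ (Prod.ext ?_ ?_)⟩
    · ext y
      have h2 : ∀ c, c * (m.fst a * y - m.fst (a * y)) = 0 := by
        intro c
        rw [mul_sub, ← mul_assoc, ← m.central, ← m.central, mul_assoc, sub_self]
      have h3 := h2 (star (m.fst a * y - m.fst (a * y)))
      rw [CStarRing.star_mul_self_eq_zero_iff, sub_eq_zero] at h3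
      simpa using h3
    · ext y
      simpa using (m.central y a).symm

variable {E}

lemma mem_canonicalIdeal {m : 𝓜(ℂ, E)} :
    m ∈ canonicalIdeal E ↔ ∃ a : E, (a : 𝓜(ℂ, E)) = m := Iff.rfl

lemma star_mem_canonicalIdeal {m : 𝓜(ℂ, E)} (hm : m ∈ canonicalIdeal E) :
    star m ∈ canonicalIdeal E := by
  obtain ⟨a, rfl⟩ := hm
  exact ⟨star a, map_star (DoubleCentralizer.coeHom (𝕜 := ℂ) (A := E)) a⟩

instance : (canonicalIdeal E).IsTwoSided where
  mul_mem_of_left {a} b ha := by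
    have h := star_mem_canonicalIdeal
      ((canonicalIdeal E).mul_mem_left (star b) (star_mem_canonicalIdeal ha))
    simpa using h

lemma norm_coe_multiplier (a : E) : ‖(a : 𝓜(ℂ, E))‖ = ‖a‖ := by
  rw [← DoubleCentralizer.norm_fst, DoubleCentralizer.coe_fst,
    ContinuousLinearMap.opNorm_mul_apply]

instance isClosed_canonicalIdeal : IsClosed (canonicalIdeal E : Set 𝓜(ℂ, E)) := by
  have h : Isometry (DoubleCentralizer.coeHom (𝕜 := ℂ) (A := E)) :=
    AddMonoidHomClass.isometry_of_norm _ norm_coe_multiplier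
  exact h.isClosedEmbedding.isClosed_range

variable (E)

/-- The corona algebra `C(E) = M(E) / E`, with the quotient `*`-algebra structure and the
quotient norm. -/
def Corona : Type _ := 𝓜(ℂ, E) ⧸ canonicalIdeal E

namespace Corona

instance : Ring (Corona E) := inferInstanceAs (Ring (𝓜(ℂ, E) ⧸ canonicalIdeal E))

instance : Algebra ℂ (Corona E) := inferInstanceAs (Algebra ℂ (𝓜(ℂ, E) ⧸ canonicalIdeal E))

instance : NormedAddCommGroup (Corona E) :=
  inferInstanceAs (NormedAddCommGroup (𝓜(ℂ, E) ⧸ canonicalIdeal E))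

instance : NormedSpace ℂ (Corona E) :=
  inferInstanceAs (NormedSpace ℂ (𝓜(ℂ, E) ⧸ canonicalIdeal E))

instance : CompleteSpace (Corona E) :=
  inferInstanceAs (CompleteSpace (𝓜(ℂ, E) ⧸ canonicalIdeal E))

/-- The quotient map `π : M(E) → C(E)`. -/
def mk : 𝓜(ℂ, E) →ₐ[ℂ] Corona E := Ideal.Quotient.mkₐ ℂ (canonicalIdeal E)

variable {E}

lemma mk_surjective : Function.Surjective (mk E) := Ideal.Quotient.mk_surjective

lemma mk_eq_mk {m n : 𝓜(ℂ, E)} : mk E m = mk E n ↔ ∃ a : E, (a : 𝓜(ℂ, E)) = m - n :=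
  Ideal.Quotient.eq.trans mem_canonicalIdeal

lemma norm_mk_le (m : 𝓜(ℂ, E)) : ‖mk E m‖ ≤ ‖m‖ :=
  Submodule.Quotient.norm_mk_le (canonicalIdeal E) m

lemma exists_norm_lt (x : Corona E) {ε : ℝ} (hε : 0 < ε) :
    ∃ m : 𝓜(ℂ, E), mk E m = x ∧ ‖m‖ < ‖x‖ + ε :=
  Submodule.Quotient.norm_mk_lt (S := canonicalIdeal E) x hε

instance : Star (Corona E) where
  star := Quotient.lift (fun m : 𝓜(ℂ, E) => mk E (star m)) (by
    intro m n h
    have h' : m - n ∈ canonicalIdeal E := (Submodule.quotientRel_def _).1 h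
    exact mk_eq_mk.2 (by
      obtain ⟨a, ha⟩ := star_mem_canonicalIdeal h'
      exact ⟨a, by simpa using ha⟩))

lemma star_mk (m : 𝓜(ℂ, E)) : star (mk E m) = mk E (star m) := rfl

instance : StarRing (Corona E) where
  star_involutive x := by
    obtain ⟨m, rfl⟩ := mk_surjective x
    simp [star_mk]
  star_mul x y := by
    obtain ⟨m, rfl⟩ := mk_surjective x
    obtain ⟨n, rfl⟩ := mk_surjective y
    simp [star_mk, ← map_mul]
  star_add x y := by
    obtain ⟨m, rfl⟩ := mk_surjective x
    obtain ⟨n, rfl⟩ := mk_surjective y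
    simp [star_mk, ← map_add]

instance : StarModule ℂ (Corona E) where
  star_smul c x := by
    obtain ⟨m, rfl⟩ := mk_surjective x
    simp [star_mk, ← map_smul]

instance : NormedRing (Corona E) where
  __ := (inferInstance : NormedAddCommGroup (Corona E))
  __ := (inferInstance : Ring (Corona E))
  norm_mul_le x y := by
    have key : ∀ ε : ℝ, 0 < ε → ‖x * y‖ ≤ (‖x‖ + ε) * (‖y‖ + ε) := by
      intro ε hε
      obtain ⟨m, rfl, hm⟩ := exists_norm_lt x hε
      obtain ⟨n, rfl, hn⟩ := exists_norm_lt y hε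
      rw [← map_mul]
      exact (norm_mk_le _).trans ((norm_mul_le _ _).trans
        (mul_le_mul hm.le hn.le (norm_nonneg _) (by positivity)))
    have hlim : Tendsto (fun ε : ℝ => (‖x‖ + ε) * (‖y‖ + ε)) (𝓝[>] 0) (𝓝 (‖x‖ * ‖y‖)) := by
      have : Continuous (fun ε : ℝ => (‖x‖ + ε) * (‖y‖ + ε)) := by fun_prop
      simpa using (this.tendsto 0).mono_left nhdsWithin_le_nhds
    exact ge_of_tendsto hlim (by filter_upwards [self_mem_nhdsWithin] with ε hε using key ε hε)

instance : NormedAlgebra ℂ (Corona E) where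
  __ := (inferInstance : Algebra ℂ (Corona E))
  norm_smul_le := norm_smul_le

lemma norm_mk_mul_self_le (m : 𝓜(ℂ, E)) : ‖mk E m‖ * ‖mk E m‖ ≤ ‖mk E (star m * m)‖ := by
  let _ := CStarAlgebra.spectralOrder E
  have _ := CStarAlgebra.spectralOrderedRing E
  let _ := CStarAlgebra.spectralOrder 𝓜(ℂ, E)
  have _ := CStarAlgebra.spectralOrderedRing 𝓜(ℂ, E)
  refine le_of_forall_pos_le_add fun ε hε => ?_
  obtain ⟨b, hb, hbn⟩ := exists_norm_lt (mk E (star m * m)) (half_pos hε)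
  obtain ⟨a, ha⟩ := mk_eq_mk.1 hb
  have hu := CStarAlgebra.increasingApproximateUnit E
  have : (CStarAlgebra.approximateUnit E).NeBot := hu.neBot
  have hlim := (hu.tendsto_mul_left a)
  obtain ⟨e, he0, he1, hae⟩ := (hu.eventually_nonneg.and (hu.eventually_norm.and
    (hlim.eventually (Metric.ball_mem_nhds a (half_pos hε))))).exists
  set f : 𝓜(ℂ, E) := (e : 𝓜(ℂ, E)) with hf
  have hf0 : 0 ≤ f := by
    obtain ⟨c, rfl⟩ := CStarAlgebra.nonneg_iff_eq_star_mul_self.1 he0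
    refine CStarAlgebra.nonneg_iff_eq_star_mul_self.2 ⟨(c : 𝓜(ℂ, E)), ?_⟩
    have h1 := map_mul (DoubleCentralizer.coeHom (𝕜 := ℂ) (A := E)) (star c) c
    rw [map_star] at h1
    exact h1
  have hf1 : f ∈ Set.Icc 0 1 :=
    CStarAlgebra.mem_Icc_iff_norm_le_one.2 ⟨hf0, by rw [hf, norm_coe_multiplier]; exact he1⟩
  have hg : 1 - f ∈ Set.Icc 0 1 := Set.sub_mem_Icc_zero_iff_right.2 hf1
  have hgn : ‖1 - f‖ ≤ 1 := (CStarAlgebra.mem_Icc_iff_norm_le_one.1 hg).2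
  have hq : mk E m = mk E (m * (1 - f)) := by
    obtain ⟨c, hc⟩ := (canonicalIdeal E).mul_mem_left m (mem_canonicalIdeal.2 ⟨e, rfl⟩)
    refine mk_eq_mk.2 ⟨c, ?_⟩
    rw [mul_sub, mul_one, sub_sub_cancel]
    exact hc
  have hjf : ‖(a : 𝓜(ℂ, E)) * (1 - f)‖ < ε / 2 := by
    have h1 : (a : 𝓜(ℂ, E)) * (1 - f) = ((a - a * e : E) : 𝓜(ℂ, E)) := by
      have h2 := map_sub (DoubleCentralizer.coeHom (𝕜 := ℂ) (A := E)) a (a * e)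
      rw [map_mul] at h2
      rw [mul_sub, mul_one]
      exact h2.symm
    rw [h1, norm_coe_multiplier, ← dist_eq_norm, dist_comm]
    exact hae
  have hdecomp : star m * m * (1 - f) = b * (1 - f) - (a : 𝓜(ℂ, E)) * (1 - f) := by
    rw [ha]; noncomm_ring
  calc ‖mk E m‖ * ‖mk E m‖ ≤ ‖m * (1 - f)‖ * ‖m * (1 - f)‖ := by
        rw [hq]; exact mul_self_le_mul_self (norm_nonneg _) (norm_mk_le _)
    _ = ‖star (1 - f) * (star m * m * (1 - f))‖ := by
        rw [← CStarRing.norm_star_mul_self, star_mul]; simp only [mul_assoc]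
    _ ≤ ‖star (1 - f)‖ * ‖star m * m * (1 - f)‖ := norm_mul_le _ _
    _ ≤ 1 * ‖star m * m * (1 - f)‖ := by
        rw [norm_star]; exact mul_le_mul_of_nonneg_right hgn (norm_nonneg _)
    _ ≤ ‖b * (1 - f)‖ + ‖(a : 𝓜(ℂ, E)) * (1 - f)‖ := by
        rw [one_mul, hdecomp]; exact norm_sub_le _ _
    _ ≤ ‖b‖ + ε / 2 := by
        refine add_le_add ((norm_mul_le _ _).trans ?_) hjf.le
        exact mul_le_of_le_one_right (norm_nonneg _) hgn
    _ ≤ ‖mk E (star m * m)‖ + ε := by linarith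

instance : CStarRing (Corona E) where
  norm_mul_self_le x := by
    obtain ⟨m, rfl⟩ := mk_surjective x
    rw [star_mk, ← map_mul]
    exact norm_mk_mul_self_le m

instance : CStarAlgebra (Corona E) where

end Corona

end Corona

/-! ### Hypotheses on C⋆-algebras -/

/-- `E` is nonunital: it has no unit element. -/
def IsNonunital (E : Type*) [NonUnitalCStarAlgebra E] : Prop :=
  ¬ ∃ e : E, ∀ a : E, e * a = a ∧ a * e = a

/-- `E` is σ-unital: it has a sequential approximate unit consisting of positive contractions
(positive elements of a C⋆-algebra are those of the form `star b * b`). -/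
def IsSigmaUnital (E : Type*) [NonUnitalCStarAlgebra E] : Prop :=
  ∃ e : ℕ → E, (∀ n, (∃ b : E, e n = star b * b) ∧ ‖e n‖ ≤ 1) ∧
    ∀ a : E, Tendsto (fun n => e n * a) atTop (𝓝 a) ∧ Tendsto (fun n => a * e n) atTop (𝓝 a)

/-! ### Extensions and their equivalences -/

section Extension

variable {D E : Type*} [NonUnitalCStarAlgebra D] [NonUnitalCStarAlgebra E]

/-- An extension of `E` by `D`, identified with its Busby invariant: a (not necessarily unital or
injective) `*`-homomorphism `D → C(E)`. -/
abbrev Extension (D E : Type*) [NonUnitalCStarAlgebra D] [NonUnitalCStarAlgebra E] : Type _ :=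
  D →⋆ₙₐ[ℂ] Corona E

/-- There is a norm-continuous path `(u_t)`, `t ∈ [1, ∞)`, of unitaries of `C(E)` with
`u_t φ(a) u_t* → ψ(a)` in norm for every `a`. -/
def AsymptoticallyUnitarilyEquivalent (φ ψ : Extension D E) : Prop :=
  ∃ u : Set.Ici (1 : ℝ) → unitary (Corona E), Continuous u ∧
    ∀ a : D, Tendsto (fun t => (u t : Corona E) * φ a * star (u t : Corona E)) atTop (𝓝 (ψ a))

/-- There is a unitary `w` of `C(E)` with `w φ(a) w* = ψ(a)` for every `a`. -/
def WeaklyUnitarilyEquivalent (φ ψ : Extension D E) : Prop :=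
  ∃ w : unitary (Corona E), ∀ a : D, (w : Corona E) * φ a * star (w : Corona E) = ψ a

end Extension

end CStarExt

end

/-! A constant path gives the easy direction. For the converse, continuity lets the path be sampled
at times tending to infinity so slowly that consecutive unitaries `u n` satisfy `‖u (n+1) - u n‖ →
0`. Separability reduces the problem to sequences `x j`, `y j` in the corona with `u n * x j - y j *
u n → 0`. It remains to replace the asymptotic intertwining by an exact one
(`exists_unitary_intertwiner`).

Lift `u n` to bounded multipliers `U n` and glue them: `W (n+1) = c n * W n * c n + s n * U (n+1) *
s n`, where `c n ∈ E`, `s n ∈ 1 + E`, `c² + s² = 1`, and both almost commute with everything used so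
far (`exists_isQuasicentralPair`). Then `W n` still lifts `u n`. Since `s n` almost annihilates the
elements of `E` already seen, `W n` converges strictly to a multiplier `w`.

The defects `W n * X j - Y j * W n`, `W n * star (W n) - 1` and `star (W n) * W n - 1` do better:
they are norm Cauchy. Up to summable errors, each step replaces the distance to an earlier defect by
its maximum with a quantity tending to zero. A maximum does not accumulate under iteration
(`norm_mul_add_mul_le`, `cauchySeq_of_norm_step`). The images of the defects in the corona tend to
zero, so their norm limits lie in `E`. These coincide with the strict limits, which are the defects
of `w`; hence the image of `w` is a unitary intertwining exactly. -/

namespace CStarExt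

/-! ### Norm estimates for gluing, and quasicentral elements of an ideal. -/

section CStarAlgebraLemmas

variable {A : Type*} [CStarAlgebra A]

/-- The element is a corner of `diag(x, b)` conjugated by the unitary rotation with entries `c` and
`±s`. Concretely, with `T` the sum, `star T * T` falls short of `c * (star x * x) * c + s * (star b
* b) * s` by `star z * z`, where `z = s * x * c - c * b * s` is the off-diagonal entry. -/
lemma norm_mul_add_mul_le {c s : A} (hc : IsSelfAdjoint c) (hs : IsSelfAdjoint s)
    (hcs : c * s = s * c) (h1 : c * c + s * s = 1) (x b : A) :
    ‖c * x * c + s * b * s‖ ≤ max ‖x‖ ‖b‖ := by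
  let _ := CStarAlgebra.spectralOrder A
  have _ := CStarAlgebra.spectralOrderedRing A
  set m := max ‖x‖ ‖b‖ with hm
  have hm0 : 0 ≤ m := (norm_nonneg x).trans (le_max_left _ _)
  have key : star (c * x * c + s * b * s) * (c * x * c + s * b * s)
      ≤ algebraMap ℝ A (m ^ 2) := by
    have hx : star x * x ≤ algebraMap ℝ A (m ^ 2) :=
      CStarAlgebra.star_mul_le_algebraMap_norm_sq.trans
        (algebraMap_mono A (pow_le_pow_left₀ (norm_nonneg _) (le_max_left _ _) 2))
    have hb : star b * b ≤ algebraMap ℝ A (m ^ 2) :=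
      CStarAlgebra.star_mul_le_algebraMap_norm_sq.trans
        (algebraMap_mono A (pow_le_pow_left₀ (norm_nonneg _) (le_max_right _ _) 2))
    have hx' := star_left_conjugate_le_conjugate hx c
    have hb' := star_left_conjugate_le_conjugate hb s
    rw [hc.star_eq] at hx'
    rw [hs.star_eq] at hb'
    have h2 : c * algebraMap ℝ A (m ^ 2) * c + s * algebraMap ℝ A (m ^ 2) * s
        = algebraMap ℝ A (m ^ 2) := by
      rw [← Algebra.commutes, ← Algebra.commutes, mul_assoc, mul_assoc, ← mul_add, h1, mul_one]
    refine le_trans ?_ ((add_le_add hx' hb').trans_eq h2)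
    rw [← sub_nonneg]
    have h3 : c * (star x * x) * c + s * (star b * b) * s
        - star (c * x * c + s * b * s) * (c * x * c + s * b * s)
        = star (s * (x * c) - c * (b * s)) * (s * (x * c) - c * (b * s)) := by
      simp only [star_add, star_sub, star_mul, hc.star_eq, hs.star_eq]
      linear_combination (norm := noncomm_ring) -(c * star x) * h1 * (x * c)
        - (s * star b) * h1 * (b * s) - (c * star x) * hcs * (b * s)
        + (s * star b) * hcs * (x * c)
    rw [h3]
    exact star_mul_self_nonneg _
  have h4 := CStarAlgebra.norm_le_norm_of_nonneg_of_le (star_mul_self_nonneg _) key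
  rw [CStarRing.norm_star_mul_self, ← sq] at h4
  rcases subsingleton_or_nontrivial A with hA | hA
  · rwa [Subsingleton.elim (c * x * c + s * b * s) 0, norm_zero]
  rw [norm_algebraMap', Real.norm_of_nonneg (by positivity)] at h4
  exact (pow_le_pow_iff_left₀ (norm_nonneg _) hm0 two_ne_zero).1 h4

lemma norm_le_one_of_sq_add_sq {c s : A} (hc : IsSelfAdjoint c) (hs : IsSelfAdjoint s)
    (hcs : c * s = s * c) (h1 : c * c + s * s = 1) : ‖c‖ ≤ 1 := by
  have h := norm_mul_add_mul_le hc hs hcs h1 1 0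
  rcases subsingleton_or_nontrivial A with hA | hA
  · simp [Subsingleton.elim c 0]
  · have h2 : ‖star c * c‖ = ‖c‖ * ‖c‖ := CStarRing.norm_star_mul_self
    rw [hc.star_eq] at h2
    simp [h2] at h
    nlinarith [norm_nonneg c]

variable (J : Ideal A) [J.IsTwoSided]

/-- An average of `m` approximate-unit elements chosen successively is quasicentral, with no appeal
to Hahn–Banach. Write `[e, x] = e x (1 - e) - (1 - e) x e`. Each new `e` nearly fixes the sum of the
earlier terms `e x (1 - e)`, so the new term is almost orthogonal to that sum. Its norm therefore
grows like `√m`, which averaging beats. -/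
lemma exists_quasicentral (h : ℕ → A) (hJ : ∀ n, h n ∈ J) (hsa : ∀ n, IsSelfAdjoint (h n))
    (hn : ∀ n, ‖h n‖ ≤ 1) (hl : ∀ a ∈ J, Tendsto (fun n => h n * a) atTop (𝓝 a))
    (hr : ∀ a ∈ J, Tendsto (fun n => a * h n) atTop (𝓝 a)) {F : Set A} (hF : F.Finite)
    {ε : ℝ} (hε : 0 < ε) :
    ∃ e ∈ J, IsSelfAdjoint e ∧ ‖e‖ ≤ 1 ∧ (∀ x ∈ F, ‖e * x - x * e‖ ≤ ε) ∧
      ∀ a ∈ F, a ∈ J → ‖(1 - e) * a‖ ≤ ε ∧ ‖a * (1 - e)‖ ≤ ε := by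
  obtain ⟨B, hB⟩ := (hF.image norm).bddAbove
  replace hB : ∀ x ∈ F, ‖x‖ ≤ |B| := fun x hx => (hB ⟨x, hx, rfl⟩).trans (le_abs_self B)
  have hB0 : 0 ≤ |B| := abs_nonneg B
  set G : Set A := F ∪ star F with hG
  have hGfin : G.Finite := hF.union hF.star
  have hGB : ∀ x ∈ G, ‖x‖ ≤ |B| := by
    rintro x (hx | hx)
    · exact hB x hx
    · simpa using hB _ hx
  -- `T` is the sum of the chosen elements and `S x` the sum of the terms `e * x * (1 - e)`. The
  -- increment `4 * |B| ^ 2 + 1` of the bound on `‖S x‖ ^ 2` is the square of the new term plus two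
  -- cross terms of at most `1 / 2`.
  have step : ∀ m : ℕ, ∃ (T : A) (S : A → A), T ∈ J ∧ (∀ x, S x ∈ J) ∧ IsSelfAdjoint T ∧
      ‖T‖ ≤ m ∧ (∀ x, T * x - x * T = S x - star (S (star x))) ∧
      (∀ x ∈ G, ‖S x‖ ^ 2 ≤ m * (4 * |B| ^ 2 + 1)) ∧
      ∀ a ∈ F, a ∈ J → ‖((m : A) - T) * a‖ ≤ m * ε ∧ ‖a * ((m : A) - T)‖ ≤ m * ε := by
    intro m
    induction m with
    | zero =>
      exact ⟨0, fun _ => 0, J.zero_mem, fun _ => J.zero_mem, .zero A, by simp, by simp, by simp,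
        by simp⟩
    | succ m ih =>
      obtain ⟨T, S, hTJ, hSJ, hT, hTn, hTS, hS, hTF⟩ := ih
      have ev1 : ∀ᶠ n in atTop, ∀ x ∈ G, ‖S x * (1 - h n)‖ * |B| ≤ 1 / 2 := by
        rw [eventually_all_finite hGfin]
        intro x _
        have h1 : Tendsto (fun n => ‖S x * (1 - h n)‖ * |B|) atTop (𝓝 (‖S x - S x‖ * |B|)) := by
          simp only [mul_sub, mul_one]
          exact ((tendsto_const_nhds.sub (hr _ (hSJ x))).norm).mul_const _
        rw [sub_self, norm_zero, zero_mul] at h1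
        exact (h1.eventually (gt_mem_nhds (by norm_num : (0 : ℝ) < 1 / 2))).mono fun _ => le_of_lt
      have ev2 : ∀ᶠ n in atTop, ∀ a ∈ F, a ∈ J → ‖(1 - h n) * a‖ ≤ ε ∧ ‖a * (1 - h n)‖ ≤ ε := by
        rw [eventually_all_finite hF]
        intro a _
        by_cases ha : a ∈ J
        swap
        · exact .of_forall fun _ h => (ha h).elim
        have h1 : Tendsto (fun n => ‖(1 - h n) * a‖) atTop (𝓝 (‖a - a‖)) := by
          simp only [sub_mul, one_mul]
          exact (tendsto_const_nhds.sub (hl a ha)).norm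
        have h2 : Tendsto (fun n => ‖a * (1 - h n)‖) atTop (𝓝 (‖a - a‖)) := by
          simp only [mul_sub, mul_one]
          exact (tendsto_const_nhds.sub (hr a ha)).norm
        rw [sub_self, norm_zero] at h1 h2
        filter_upwards [h1.eventually (gt_mem_nhds hε), h2.eventually (gt_mem_nhds hε)]
          with n k1 k2 _ using ⟨k1.le, k2.le⟩
      obtain ⟨n, hn1, hn2⟩ := (ev1.and ev2).exists
      set e := h n with he
      have he1 : ‖e‖ ≤ 1 := hn n
      have hesa : star e = e := (hsa n).star_eq
      have hone : ‖(1 : A)‖ ≤ 1 := by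
        rcases subsingleton_or_nontrivial A with hA | hA
        · simp [Subsingleton.elim (1 : A) 0]
        · simp
      have he2 : ‖1 - e‖ ≤ 2 := (norm_sub_le _ _).trans (by linarith)
      refine ⟨T + e, fun x => S x + e * x * (1 - e), J.add_mem hTJ (hJ n),
        fun x => J.add_mem (hSJ x) (J.mul_mem_right _ (J.mul_mem_right _ (hJ n))),
        hT.add (hsa n), ?_, ?_, ?_, ?_⟩
      · push_cast
        exact (norm_add_le _ _).trans (add_le_add hTn he1)
      · intro x
        have := hTS x
        simp only [star_add, star_mul, star_sub, star_one, hesa, star_star]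
        linear_combination (norm := noncomm_ring) this
      · intro x hx
        have hxB := hGB x hx
        set y := e * x * (1 - e) with hy
        have hy1 : ‖y‖ ≤ 2 * |B| := by
          have := norm_mul_le_of_le (norm_mul_le_of_le he1 hxB) he2
          linarith
        have hc : ‖S x * star y‖ ≤ 1 / 2 := by
          have h1 : S x * star y = S x * (1 - e) * (star x * e) := by
            simp only [hy, star_mul, star_sub, star_one, hesa, mul_assoc]
          have h2 : ‖star x * e‖ ≤ |B| := by
            have := norm_mul_le_of_le ((norm_star x).trans_le hxB) he1
            linarith
          rw [h1]
          exact (norm_mul_le_of_le le_rfl h2).trans (hn1 x hx)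
        have hc' : ‖y * star (S x)‖ ≤ 1 / 2 := by
          rw [← norm_star, star_mul, star_star]; exact hc
        have hSx := hS x hx
        have e1 : ‖S x + y‖ ^ 2 = ‖S x * star (S x) + S x * star y + y * star (S x)
            + y * star y‖ := by
          rw [sq, ← CStarRing.norm_self_mul_star]
          congr 1
          rw [star_add]; noncomm_ring
        have e2 : ‖S x * star (S x)‖ = ‖S x‖ ^ 2 := by rw [CStarRing.norm_self_mul_star, sq]
        have e3 : ‖y * star y‖ = ‖y‖ ^ 2 := by rw [CStarRing.norm_self_mul_star, sq]
        have e4 : ‖y‖ ^ 2 ≤ (2 * |B|) ^ 2 := pow_le_pow_left₀ (norm_nonneg _) hy1 2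
        rw [e1]
        have e5 := norm_add₄_le (a := S x * star (S x)) (b := S x * star y)
          (c := y * star (S x)) (d := y * star y)
        push_cast
        nlinarith
      · intro a ha haJ
        obtain ⟨h1, h2⟩ := hTF a ha haJ
        obtain ⟨h3, h4⟩ := hn2 a ha haJ
        push_cast
        constructor
        · calc ‖((m : A) + 1 - (T + e)) * a‖ = ‖((m : A) - T) * a + (1 - e) * a‖ := by
                congr 1; noncomm_ring
            _ ≤ (m + 1) * ε := (norm_add_le _ _).trans (by linarith)
        · calc ‖a * ((m : A) + 1 - (T + e))‖ = ‖a * ((m : A) - T) + a * (1 - e)‖ := by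
                congr 1; noncomm_ring
            _ ≤ (m + 1) * ε := (norm_add_le _ _).trans (by linarith)
  set K := 4 * |B| ^ 2 + 1 with hK
  have hK0 : 0 < K := by positivity
  -- This size of `m` forces `√(m K) ≤ m ε / 2`, so the two halves of the commutator of the average
  -- add up to at most `ε`.
  obtain ⟨m, hm⟩ := exists_nat_gt (4 * K / ε ^ 2)
  have hm0 : (0 : ℝ) < m := lt_of_le_of_lt (by positivity) hm
  obtain ⟨T, S, hTJ, hSJ, hT, hTn, hTS, hS, hTF⟩ := step m
  have hnorm : ∀ y : A, ‖((m : ℝ)⁻¹) • y‖ = (m : ℝ)⁻¹ * ‖y‖ := fun y => by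
    rw [norm_smul, Real.norm_of_nonneg (by positivity)]
  have h1T : 1 - ((m : ℝ)⁻¹) • T = ((m : ℝ)⁻¹) • ((m : A) - T) := by
    rw [smul_sub]
    congr 1
    rw [← map_natCast (algebraMap ℝ A) m, Algebra.smul_def, ← map_mul,
      inv_mul_cancel₀ hm0.ne', map_one]
  refine ⟨((m : ℝ)⁻¹) • T, ?_, ?_, ?_, ?_, ?_⟩
  · rw [Algebra.smul_def]; exact J.mul_mem_left _ hTJ
  · exact (IsSelfAdjoint.all ((m : ℝ)⁻¹)).smul hT
  · rw [hnorm, inv_mul_le_iff₀ hm0]; linarith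
  · intro x hx
    rw [smul_mul_assoc, mul_smul_comm, ← smul_sub, hnorm, hTS, inv_mul_le_iff₀ hm0]
    have b1 : ∀ y ∈ G, ‖S y‖ ≤ m * ε / 2 := by
      intro y hy
      refine (pow_le_pow_iff_left₀ (norm_nonneg _) (by positivity) two_ne_zero).1
        ((hS y hy).trans ?_)
      rw [div_lt_iff₀ (by positivity)] at hm
      nlinarith
    have b2 := b1 x (Or.inl hx)
    have b3 := b1 (star x) (Or.inr (by simpa using hx))
    refine (norm_sub_le _ _).trans ?_
    rw [norm_star]
    linarith
  · intro a ha haJ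
    obtain ⟨h1, h2⟩ := hTF a ha haJ
    rw [h1T, smul_mul_assoc, mul_smul_comm, hnorm, hnorm, inv_mul_le_iff₀ hm0,
      inv_mul_le_iff₀ hm0]
    exact ⟨h1, h2⟩

end CStarAlgebraLemmas

/-! ### Quasicentral partitions `c² + s² = 1` and gluing of two multipliers. -/

section QuasicentralPair

variable {A : Type*} [CStarAlgebra A]

/-- Commuting self-adjoint elements `c ∈ J` and `s ∈ 1 + J` with `c² + s² = 1` which commute with
`F` up to `ε` and such that `s` annihilates `F ∩ J` up to `ε`. -/
structure IsQuasicentralPair (J : Ideal A) (F : Set A) (ε : ℝ) (c s : A) : Prop where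
  mem : c ∈ J
  one_sub_mem : 1 - s ∈ J
  isSelfAdjoint_left : IsSelfAdjoint c
  isSelfAdjoint_right : IsSelfAdjoint s
  comm : c * s = s * c
  sq_add_sq : c * c + s * s = 1
  comm_left : ∀ x ∈ F, ‖c * x - x * c‖ ≤ ε
  comm_right : ∀ x ∈ F, ‖s * x - x * s‖ ≤ ε
  norm_mul_le : ∀ x ∈ F, x ∈ J → ‖s * x‖ ≤ ε ∧ ‖x * s‖ ≤ ε

/-- The rational parametrisation of the circle, `c = 2e / (1 + e²)` and `s = (1 - e²) / (1 + e²)`,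
is applied to a quasicentral `e`. Commutators with an inverse are controlled algebraically, so no
square root has to be estimated. The factor `1 - e` in `s` makes it small on `F ∩ J`. -/
lemma exists_isQuasicentralPair (J : Ideal A) [J.IsTwoSided]
    (h : ℕ → A) (hJ : ∀ n, h n ∈ J) (hsa : ∀ n, IsSelfAdjoint (h n))
    (hn : ∀ n, ‖h n‖ ≤ 1) (hl : ∀ a ∈ J, Tendsto (fun n => h n * a) atTop (𝓝 a))
    (hr : ∀ a ∈ J, Tendsto (fun n => a * h n) atTop (𝓝 a)) {F : Set A} (hF : F.Finite)
    {ε : ℝ} (hε : 0 < ε) : ∃ c s, IsQuasicentralPair J F ε c s := by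
  obtain ⟨e, heJ, hesa, hen, hcomm, hkill⟩ :=
    exists_quasicentral J h hJ hsa hn hl hr hF (show 0 < ε / 6 by positivity)
  -- With `g = (1 + e²)⁻¹` one has `c = 2 e g` and `s = 2 g - 1`.
  have hcont : Continuous fun t : ℝ => (1 + t ^ 2)⁻¹ :=
    (by fun_prop : Continuous fun t : ℝ => 1 + t ^ 2).inv₀ fun t => by positivity
  set g : A := cfc (fun t : ℝ => (1 + t ^ 2)⁻¹) e with hg
  have hgsa : IsSelfAdjoint g := cfc_predicate _ _
  have hgn : ‖g‖ ≤ 1 := by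
    refine norm_cfc_le zero_le_one fun t _ => ?_
    rw [Real.norm_of_nonneg (by positivity)]
    exact inv_le_one_of_one_le₀ (by nlinarith)
  have hcommeg : g * e = e * g := by
    have := (cfc_commute_cfc (fun t : ℝ => (1 + t ^ 2)⁻¹) id e).eq
    rwa [cfc_id ℝ e] at this
  have hginv : g * (1 + e * e) = 1 := by
    have h1 : (1 + e * e : A) = cfc (fun t : ℝ => 1 + t ^ 2) e := by
      rw [cfc_add (a := e) (fun _ => (1 : ℝ)) (fun t => t ^ 2), cfc_const_one ℝ e,
        cfc_pow_id (R := ℝ) e 2, sq]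
    rw [h1, hg, ← cfc_mul (fun t : ℝ => (1 + t ^ 2)⁻¹) (fun t => 1 + t ^ 2) e
      hcont.continuousOn (by fun_prop), ← cfc_const_one ℝ e]
    refine cfc_congr fun t _ => inv_mul_cancel₀ (by positivity)
  have hginv' : (1 + e * e) * g = 1 := by
    refine Eq.trans ?_ hginv
    linear_combination (norm := noncomm_ring) -e * hcommeg - hcommeg * e
  have hcg : ∀ x ∈ F, ‖g * x - x * g‖ ≤ ε / 3 := by
    intro x hx
    have h1 : g * x - x * g = g * (x * e - e * x) * e * g + g * e * (x * e - e * x) * g := by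
      linear_combination (norm := noncomm_ring) hginv * (x * g) - (g * x) * hginv'
    have h2 : ‖x * e - e * x‖ ≤ ε / 6 := by rw [norm_sub_rev]; exact hcomm x hx
    have h3 := norm_mul_le_of_le (norm_mul_le_of_le (norm_mul_le_of_le hgn h2) hen) hgn
    have h4 := norm_mul_le_of_le (norm_mul_le_of_le (norm_mul_le_of_le hgn hen) h2) hgn
    rw [h1]
    exact (norm_add_le _ _).trans (by linarith)
  refine ⟨2 * (e * g), 2 * g - 1, ?_, ?_, ?_, ?_, ?_, ?_, ?_, ?_, ?_⟩
  · exact J.mul_mem_left _ (J.mul_mem_right _ heJ)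
  · have h1 : 1 - g = e * (e * g) := by linear_combination (norm := noncomm_ring) -hginv'
    have h2 : 1 - (2 * g - 1) = (1 - g) + (1 - g) := by rw [two_mul]; abel
    rw [h2, h1]
    have h3 := J.mul_mem_left e (J.mul_mem_right g heJ)
    exact J.add_mem h3 h3
  · rw [two_mul]
    have : IsSelfAdjoint (e * g) := by
      rw [IsSelfAdjoint, star_mul, hgsa.star_eq, hesa.star_eq, hcommeg]
    exact this.add this
  · rw [two_mul]
    exact (hgsa.add hgsa).sub (.one A)
  · linear_combination (norm := noncomm_ring) -4 * hcommeg * g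
  · linear_combination (norm := noncomm_ring) 4 * e * hcommeg * g + 4 * hginv' * g
  · intro x hx
    have h1 : 2 * (e * g) * x - x * (2 * (e * g))
        = e * (g * x - x * g) + e * (g * x - x * g) + (e * x - x * e) * g
          + (e * x - x * e) * g := by noncomm_ring
    have h3 := norm_mul_le_of_le hen (hcg x hx)
    have h4 := norm_mul_le_of_le (hcomm x hx) hgn
    rw [h1]
    exact norm_add₄_le.trans (by linarith)
  · intro x hx
    have h1 : (2 * g - 1) * x - x * (2 * g - 1) = (g * x - x * g) + (g * x - x * g) := by
      noncomm_ring
    have h3 := hcg x hx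
    rw [h1]
    exact (norm_add_le _ _).trans (by linarith)
  · intro x hx hxJ
    obtain ⟨h1, h2⟩ := hkill x hx hxJ
    have h3 : (2 * g - 1) * x = g * ((1 - e) * x) + g * e * ((1 - e) * x) := by
      linear_combination (norm := noncomm_ring) hginv * x
    have h4 : x * (2 * g - 1) = x * (1 - e) * g + x * (1 - e) * e * g := by
      linear_combination (norm := noncomm_ring) x * hginv'
    have h5 := norm_mul_le_of_le hgn h1
    have h6 := norm_mul_le_of_le (norm_mul_le_of_le hgn hen) h1
    have h7 := norm_mul_le_of_le h2 hgn
    have h8 := norm_mul_le_of_le (norm_mul_le_of_le h2 hen) hgn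
    rw [h3, h4]
    exact ⟨(norm_add_le _ _).trans (by linarith), (norm_add_le _ _).trans (by linarith)⟩

namespace IsQuasicentralPair

variable {J : Ideal A} {F : Set A} {ε : ℝ} {c s : A}

lemma mono (h : IsQuasicentralPair J F ε c s) {G : Set A} (hG : G ⊆ F) :
    IsQuasicentralPair J G ε c s :=
  { h with
    comm_left := fun x hx => h.comm_left x (hG hx)
    comm_right := fun x hx => h.comm_right x (hG hx)
    norm_mul_le := fun x hx => h.norm_mul_le x (hG hx) }

lemma norm_left (h : IsQuasicentralPair J F ε c s) : ‖c‖ ≤ 1 :=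
  norm_le_one_of_sq_add_sq h.isSelfAdjoint_left h.isSelfAdjoint_right h.comm h.sq_add_sq

lemma norm_right (h : IsQuasicentralPair J F ε c s) : ‖s‖ ≤ 1 :=
  norm_le_one_of_sq_add_sq h.isSelfAdjoint_right h.isSelfAdjoint_left h.comm.symm
    (by rw [add_comm]; exact h.sq_add_sq)

lemma norm_add_le_max (h : IsQuasicentralPair J F ε c s) (x b : A) :
    ‖c * x * c + s * b * s‖ ≤ max ‖x‖ ‖b‖ :=
  norm_mul_add_mul_le h.isSelfAdjoint_left h.isSelfAdjoint_right h.comm h.sq_add_sq x b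

/-- On an element of `F ∩ J` the factor `s` nearly vanishes and `c²` nearly acts as the identity, so
gluing in `U` hardly changes the action of `W`. This gives strict convergence. -/
lemma norm_interpolate_mul_sub (h : IsQuasicentralPair J F ε c s) {W U a : A}
    (hU : ‖U‖ ≤ 2) (hWF : W ∈ F) (haF : a ∈ F) (haJ : a ∈ J) (ha1 : ‖a‖ ≤ 1) (hW : ‖W‖ ≤ 2) :
    ‖(c * W * c + s * U * s) * a - W * a‖ ≤ 5 * ε := by
  have hc := h.norm_left
  have hs := h.norm_right
  have h1 := h.comm_left W hWF
  have h2 := (h.norm_mul_le a haF haJ).1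
  have key : (c * W * c + s * U * s) * a - W * a
      = (c * W - W * c) * c * a + s * U * (s * a) - W * s * (s * a) := by
    linear_combination (norm := noncomm_ring) W * h.sq_add_sq * a
  have e1 := norm_mul_le_of_le (norm_mul_le_of_le h1 hc) ha1
  have e2 := norm_mul_le_of_le (norm_mul_le_of_le hs hU) h2
  have e3 := norm_mul_le_of_le (norm_mul_le_of_le hW hs) h2
  rw [key]
  exact (norm_sub_le _ _).trans ((add_le_add_left (norm_add_le _ _) _).trans (by linarith))

/-- Up to commutators, the new defect minus the reference `D` is `c (W X - Y W - D) c + s (U X - Y U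
- D) s`. Under `s` the elements `U X - Y U` and `D` may be replaced by `b'` and `b`, which agree
with them modulo `J`. In use these are nearly norm-minimal lifts of small corona elements. -/
lemma norm_interpolate_intertwine_sub (h : IsQuasicentralPair J F ε c s) {W U X Y D b b' : A}
    (hW : ‖W‖ ≤ 2) (hU : ‖U‖ ≤ 2) (hX : X ∈ F) (hY : Y ∈ F) (hD : D ∈ F)
    (hb : D - b ∈ F) (hbJ : D - b ∈ J)
    (hb' : U * X - Y * U - b' ∈ F) (hbJ' : U * X - Y * U - b' ∈ J) :
    ‖(c * W * c + s * U * s) * X - Y * (c * W * c + s * U * s) - D‖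
      ≤ max ‖W * X - Y * W - D‖ ‖b' - b‖ + 12 * ε := by
  have hc := h.norm_left
  have hs := h.norm_right
  have key : (c * W * c + s * U * s) * X - Y * (c * W * c + s * U * s) - D
      = (c * (W * X - Y * W - D) * c + s * (b' - b) * s)
        + c * W * (c * X - X * c) + (c * Y - Y * c) * (W * c)
        + s * U * (s * X - X * s) + (s * Y - Y * s) * (U * s)
        - c * (c * D - D * c) - s * (s * D - D * s)
        + s * (U * X - Y * U - b') * s - s * (D - b) * s := by
    linear_combination (norm := noncomm_ring) h.sq_add_sq * D
  have e0 := h.norm_add_le_max (W * X - Y * W - D) (b' - b)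
  have e1 := norm_mul_le_of_le (norm_mul_le_of_le hc hW) (h.comm_left X hX)
  have e2 := norm_mul_le_of_le (h.comm_left Y hY) (norm_mul_le_of_le hW hc)
  have e3 := norm_mul_le_of_le (norm_mul_le_of_le hs hU) (h.comm_right X hX)
  have e4 := norm_mul_le_of_le (h.comm_right Y hY) (norm_mul_le_of_le hU hs)
  have e5 := norm_mul_le_of_le hc (h.comm_left D hD)
  have e6 := norm_mul_le_of_le hs (h.comm_right D hD)
  have e7 := norm_mul_le_of_le (h.norm_mul_le _ hb' hbJ').1 hs
  have e8 := norm_mul_le_of_le (h.norm_mul_le _ hb hbJ).1 hs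
  rw [key]
  refine (norm_sub_le_of_le (norm_add_le_of_le (norm_sub_le_of_le (norm_sub_le_of_le
    (norm_add_le_of_le (norm_add_le_of_le (norm_add_le_of_le (norm_add_le_of_le e0 e1) e2) e3) e4)
    e5) e6) e7) e8).trans (by linarith)

/-- Expand the product against `1 = c⁴ + 2 c² s² + s⁴`. The `c⁴` part carries `W V - 1`, and the
cross terms carry `W Z + U V - 2`, replaced by `r` modulo what `s` annihilates. The `s⁴` part
carries `U Z - 1 ∈ J`, which is negligible. In use `r` is small because consecutive unitaries are
close. -/
lemma norm_interpolate_product_sub [J.IsTwoSided] (h : IsQuasicentralPair J F ε c s)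
    {W V U Z P r : A} (hW : ‖W‖ ≤ 2) (hV : ‖V‖ ≤ 2) (hU : ‖U‖ ≤ 2) (hZ : ‖Z‖ ≤ 2)
    (hWF : W ∈ F) (hVF : V ∈ F) (hUF : U ∈ F) (hZF : Z ∈ F)
    (hP : P ∈ F) (hPJ : P ∈ J) (hr : W * Z + U * V - 2 - r ∈ F) (hrJ : W * Z + U * V - 2 - r ∈ J)
    (hUZ : U * Z - 1 ∈ F) (hUZJ : U * Z - 1 ∈ J) :
    ‖(c * W * c + s * U * s) * (c * V * c + s * Z * s) - 1 - P‖
      ≤ max ‖W * V - 1 - P‖ ‖r‖ + 20 * ε := by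
  have hc := h.norm_left
  have hs := h.norm_right
  have hcs := h.comm
  have t1 : c * W * c * (c * V * c) = c * c * (W * V) * c * c
      + c * W * c * (c * V - V * c) * c - c * (c * W - W * c) * V * c * c := by noncomm_ring
  have t2 : c * W * c * (s * Z * s) = c * s * (W * Z) * s * c
      + c * W * s * (c * Z - Z * c) * s - c * (s * W - W * s) * Z * c * s := by
    linear_combination (norm := noncomm_ring) c * W * hcs * Z * s + c * s * W * Z * hcs
  have t3 : s * U * s * (c * V * c) = c * s * (U * V) * s * c
      + s * U * c * (s * V - V * s) * c - s * (c * U - U * c) * V * s * c := by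
    linear_combination (norm := noncomm_ring) - s * U * hcs * V * c - hcs * U * V * s * c
  have t4 : s * U * s * (s * Z * s) = s * s * (U * Z) * s * s
      + s * U * s * (s * Z - Z * s) * s - s * (s * U - U * s) * Z * s * s := by noncomm_ring
  have key : (c * W * c + s * U * s) * (c * V * c + s * Z * s) - 1 - P
      = c * (c * (W * V - 1 - P) * c + s * r * s) * c
        + c * W * c * (c * V - V * c) * c - c * (c * W - W * c) * V * c * c
        + c * W * s * (c * Z - Z * c) * s - c * (s * W - W * s) * Z * c * s
        + s * U * c * (s * V - V * s) * c - s * (c * U - U * c) * V * s * c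
        + s * U * s * (s * Z - Z * s) * s - s * (s * U - U * s) * Z * s * s
        + c * (s * (W * Z + U * V - 2 - r)) * s * c + s * (s * (U * Z - 1)) * s * s
        - s * (s * P) - c * c * (P * s) * s := by
    have h2 := h.sq_add_sq
    have e : (1 : A) = c * c * c * c + 2 * c * s * s * c + s * s * s * s := by
      linear_combination (norm := noncomm_ring) -h2 - h2 * (c * c + s * s) + c * hcs * s
        + c * s * hcs - hcs * s * c - s * hcs * c
    linear_combination (norm := noncomm_ring) t1 + t2 + t3 + t4 - e + h2 * P + c * c * P * h2
  have e0 : ‖c * (c * (W * V - 1 - P) * c + s * r * s) * c‖ ≤ max ‖W * V - 1 - P‖ ‖r‖ := by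
    simpa using norm_mul_le_of_le (norm_mul_le_of_le hc (h.norm_add_le_max (W * V - 1 - P) r)) hc
  have e1 := norm_mul_le_of_le (norm_mul_le_of_le (norm_mul_le_of_le (norm_mul_le_of_le hc hW)
    hc) (h.comm_left V hVF)) hc
  have e2 := norm_mul_le_of_le (norm_mul_le_of_le (norm_mul_le_of_le (norm_mul_le_of_le hc
    (h.comm_left W hWF)) hV) hc) hc
  have e3 := norm_mul_le_of_le (norm_mul_le_of_le (norm_mul_le_of_le (norm_mul_le_of_le hc hW)
    hs) (h.comm_left Z hZF)) hs
  have e4 := norm_mul_le_of_le (norm_mul_le_of_le (norm_mul_le_of_le (norm_mul_le_of_le hc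
    (h.comm_right W hWF)) hZ) hc) hs
  have e5 := norm_mul_le_of_le (norm_mul_le_of_le (norm_mul_le_of_le (norm_mul_le_of_le hs hU)
    hc) (h.comm_right V hVF)) hc
  have e6 := norm_mul_le_of_le (norm_mul_le_of_le (norm_mul_le_of_le (norm_mul_le_of_le hs
    (h.comm_left U hUF)) hV) hs) hc
  have e7 := norm_mul_le_of_le (norm_mul_le_of_le (norm_mul_le_of_le (norm_mul_le_of_le hs hU)
    hs) (h.comm_right Z hZF)) hs
  have e8 := norm_mul_le_of_le (norm_mul_le_of_le (norm_mul_le_of_le (norm_mul_le_of_le hs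
    (h.comm_right U hUF)) hZ) hs) hs
  have e9 := norm_mul_le_of_le (norm_mul_le_of_le (norm_mul_le_of_le hc (h.norm_mul_le _ hr
    hrJ).1) hs) hc
  have e10 := norm_mul_le_of_le (norm_mul_le_of_le (norm_mul_le_of_le hs (h.norm_mul_le _ hUZ
    hUZJ).1) hs) hs
  have e11 := norm_mul_le_of_le hs (h.norm_mul_le _ hP hPJ).1
  have e12 := norm_mul_le_of_le (norm_mul_le_of_le ((norm_mul_le_of_le hc hc)) (h.norm_mul_le _
    hP hPJ).2) hs
  rw [key]
  refine (norm_sub_le_of_le (norm_sub_le_of_le (norm_add_le_of_le (norm_add_le_of_le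
    (norm_sub_le_of_le (norm_add_le_of_le (norm_sub_le_of_le (norm_add_le_of_le
    (norm_sub_le_of_le (norm_add_le_of_le (norm_sub_le_of_le (norm_add_le_of_le e0 e1) e2) e3)
    e4) e5) e6) e7) e8) e9) e10) e11) e12).trans (by linarith)

end IsQuasicentralPair

end QuasicentralPair

/-! ### From one-step estimates to Cauchy sequences, and the recursive construction. -/

/-- The threshold `η` enters through a maximum and is paid once; only the geometric errors
accumulate, and the bracket is their partial sum from `n` to `k - 1`. -/
lemma le_add_two_pow_of_step {r : ℕ → ℝ} {n : ℕ} {η C : ℝ} (hη : 0 ≤ η) (hC : 0 ≤ C)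
    (h0 : r n = 0) (hr : ∀ k, n ≤ k → r (k + 1) ≤ max (r k) η + C * (1 / 2) ^ k) {k : ℕ}
    (hk : n ≤ k) : r k ≤ η + C * (2 * (1 / 2) ^ n - 2 * (1 / 2) ^ k) := by
  induction k, hk using Nat.le_induction with
  | base => rw [h0, sub_self, mul_zero, add_zero]; exact hη
  | succ k hk ih =>
    have h1 : ((1 : ℝ) / 2) ^ k ≤ (1 / 2) ^ n := pow_le_pow_of_le_one (by norm_num) (by norm_num) hk
    have h2 : max (r k) η ≤ η + C * (2 * (1 / 2) ^ n - 2 * (1 / 2) ^ k) :=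
      max_le ih (by nlinarith)
    refine (hr k hk).trans ((add_le_add_left h2 _).trans_eq ?_)
    ring

lemma cauchySeq_of_norm_step {B : Type*} [NormedAddCommGroup B] {x : ℕ → B} {β : ℕ → ℝ} {C : ℝ}
    (hC : 0 ≤ C) (N : ℕ) (hβ : Tendsto β atTop (𝓝 0))
    (hx : ∀ n k, N ≤ n → n ≤ k →
      ‖x (k + 1) - x n‖ ≤ max ‖x k - x n‖ (β k + β n) + C * (1 / 2) ^ k) :
    CauchySeq x := by
  rw [Metric.cauchySeq_iff']
  intro ε hε
  have h1 : Tendsto (fun n : ℕ => C * (2 * ((1 : ℝ) / 2) ^ n)) atTop (𝓝 0) := by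
    simpa using ((tendsto_pow_atTop_nhds_zero_of_lt_one (by norm_num : (0 : ℝ) ≤ 1 / 2)
      (by norm_num)).const_mul 2).const_mul C
  obtain ⟨n, hn⟩ := eventually_atTop.1
    ((hβ.eventually (gt_mem_nhds (show 0 < ε / 4 by positivity))).and
      ((h1.eventually (gt_mem_nhds (show 0 < ε / 2 by positivity))).and (eventually_ge_atTop N)))
  obtain ⟨hn1, hn2, hn3⟩ := hn n le_rfl
  refine ⟨n, fun k hk => ?_⟩
  rw [dist_eq_norm]
  have key := le_add_two_pow_of_step (r := fun k => ‖x k - x n‖) (η := ε / 2) (by positivity) hC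
    (by simp) (fun k hk => ((hx n k hn3 hk).trans (add_le_add_left (max_le_max le_rfl
      (by linarith [(hn k hk).1])) _))) hk
  have : 0 ≤ C * (2 * ((1 : ℝ) / 2) ^ k) := by positivity
  linarith

section Recursion

variable {A : Type*} [CStarAlgebra A]

/-- The recursion carries the current `W` together with the finite set of elements collected so far,
because the pair at stage `n` must be quasicentral for data depending on all of `W 0, …, W n`. -/
lemma exists_interpolating_seq {J : Ideal A} (hq : ∀ F : Set A, F.Finite → ∀ ε : ℝ, 0 < ε →
      ∃ c s, IsQuasicentralPair J F ε c s) (U : ℕ → A) (ext : ℕ → A → Set A)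
    (hext : ∀ n W, (ext n W).Finite) :
    ∃ W c s : ℕ → A, W 0 = U 0 ∧ (∀ n, W (n + 1) = c n * W n * c n + s n * U (n + 1) * s n) ∧
      ∀ n, IsQuasicentralPair J (⋃ k ≤ n, ext k (W k)) ((1 / 2) ^ n) (c n) (s n) := by
  choose! c s hcs using hq
  let next (n : ℕ) (p : A × Set A) : Set A := p.2 ∪ ext n p.1
  let st : ℕ → A × Set A := fun n => Nat.rec (U 0, ∅) (fun n p =>
    (c (next n p) ((1 / 2) ^ n) * p.1 * c (next n p) ((1 / 2) ^ n)
      + s (next n p) ((1 / 2) ^ n) * U (n + 1) * s (next n p) ((1 / 2) ^ n), next n p)) n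
  have hfin : ∀ n, (st n).2.Finite := by
    intro n
    induction n with
    | zero => exact Set.finite_empty
    | succ n ih => exact ih.union (hext _ _)
  have hmem : ∀ n, ⋃ k ≤ n, ext k (st k).1 ⊆ next n (st n) := by
    intro n
    induction n with
    | zero =>
      refine Set.iUnion₂_subset fun k hk => ?_
      obtain rfl : k = 0 := by omega
      exact Set.subset_union_right
    | succ n ih =>
      refine Set.iUnion₂_subset fun k hk => ?_
      rcases Nat.le_succ_iff.1 hk with hk | rfl
      · exact ((Set.subset_iUnion₂ k hk).trans ih).trans Set.subset_union_left
      · exact Set.subset_union_right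
  exact ⟨fun n => (st n).1, fun n => c (next n (st n)) ((1 / 2) ^ n),
    fun n => s (next n (st n)) ((1 / 2) ^ n), rfl, fun n => rfl, fun n =>
    (hcs _ ((hfin n).union (hext _ _)) _ (by positivity)).mono (hmem n)⟩

end Recursion

/-- A norm-continuous path indexed by `[1, ∞)` can be sampled along a sequence tending to infinity
with consecutive samples asymptotically close. -/
lemma exists_seq_tendsto_dist_succ {X : Type*} [PseudoMetricSpace X] {u : Set.Ici (1 : ℝ) → X}
    (hu : Continuous u) : ∃ t : ℕ → Set.Ici (1 : ℝ), Tendsto t atTop atTop ∧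
      Tendsto (fun n => dist (u (t (n + 1))) (u (t n))) atTop (𝓝 0) := by
  -- The bound `k + 2` covers both endpoints of a step of length at most `1` starting below `k + 1`.
  have hδ : ∀ k : ℕ, ∃ δ : ℝ, 0 < δ ∧ δ ≤ 1 ∧ ∀ x y : Set.Ici (1 : ℝ), (x : ℝ) ≤ k + 2 →
      (y : ℝ) ≤ k + 2 → dist x y ≤ δ → dist (u x) (u y) < 1 / ((k : ℝ) + 1) := by
    intro k
    have hK : IsCompact ((↑) ⁻¹' Set.Icc (1 : ℝ) (k + 2) : Set (Set.Ici (1 : ℝ))) :=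
      isClosed_Ici.isClosedEmbedding_subtypeVal.isCompact_preimage isCompact_Icc
    have := hK.uniformContinuousOn_of_continuous hu.continuousOn
    rw [Metric.uniformContinuousOn_iff] at this
    obtain ⟨δ, hδ, h⟩ := this (1 / ((k : ℝ) + 1)) (by positivity)
    refine ⟨min (δ / 2) 1, by positivity, min_le_right _ _, fun x y hx hy hxy => ?_⟩
    exact h x ⟨x.2, hx⟩ y ⟨y.2, hy⟩ (by linarith [hxy.trans (min_le_left _ _)])
  choose δ hδ0 hδ1 hδ using hδ
  let next (x : Set.Ici (1 : ℝ)) : Set.Ici (1 : ℝ) :=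
    ⟨(x : ℝ) + δ ⌊(x : ℝ)⌋₊, le_add_of_le_of_nonneg x.2 (hδ0 _).le⟩
  let t (n : ℕ) : Set.Ici (1 : ℝ) := next^[n] ⟨1, Set.self_mem_Ici⟩
  have ht : ∀ n, (t (n + 1) : ℝ) = (t n : ℝ) + δ ⌊(t n : ℝ)⌋₊ := fun n => by
    simp only [t, Function.iterate_succ_apply', next]
  have htm : Monotone fun n => (t n : ℝ) :=
    monotone_nat_of_le_succ fun n => by rw [ht]; linarith [hδ0 ⌊(t n : ℝ)⌋₊]
  have htop : Tendsto (fun n => (t n : ℝ)) atTop atTop := by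
    rcases tendsto_atTop_of_monotone htm with h | ⟨T, hT⟩
    · exact h
    -- If the times stayed bounded, only finitely many step sizes would occur, so the steps could
    -- not tend to zero.
    exfalso
    have hle : ∀ n, (t n : ℝ) ≤ T := htm.ge_of_tendsto hT
    obtain ⟨m, hm, hmin⟩ := (Finset.range (⌊T⌋₊ + 1)).exists_min_image δ ⟨0, by simp⟩
    have h1 : Tendsto (fun n => (t (n + 1) : ℝ) - t n) atTop (𝓝 0) := by
      simpa using (hT.comp (tendsto_add_atTop_nat 1)).sub hT
    have h2 : δ m ≤ 0 := ge_of_tendsto' h1 fun n => by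
      rw [ht, add_sub_cancel_left]
      exact hmin _ (Finset.mem_range.2 (Nat.lt_succ_of_le (Nat.floor_le_floor (hle n))))
    exact (hδ0 m).not_ge h2
  refine ⟨t, ?_, ?_⟩
  · rw [tendsto_atTop]
    intro b
    exact htop.eventually_ge_atTop (b : ℝ)
  · have h1 : Tendsto (fun n => 1 / ((⌊(t n : ℝ)⌋₊ : ℝ) + 1)) atTop (𝓝 0) :=
      tendsto_one_div_add_atTop_nhds_zero_nat.comp (tendsto_nat_floor_atTop.comp htop)
    refine squeeze_zero (fun _ => dist_nonneg) (fun n => (hδ ⌊(t n : ℝ)⌋₊ _ _ ?_ ?_ ?_).le) h1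
    · rw [ht]; linarith [hδ1 ⌊(t n : ℝ)⌋₊, Nat.lt_floor_add_one (t n : ℝ)]
    · linarith [Nat.lt_floor_add_one (t n : ℝ)]
    · rw [Subtype.dist_eq, ht, Real.dist_eq, add_sub_cancel_left, abs_of_pos (hδ0 _)]

/-! ### Strict convergence in the multiplier algebra. -/

section Multiplier

variable {E : Type*} [NonUnitalCStarAlgebra E]

lemma coe_mul_coe (a b : E) : (a : 𝓜(ℂ, E)) * (b : 𝓜(ℂ, E)) = ((a * b : E) : 𝓜(ℂ, E)) :=
  (map_mul (DoubleCentralizer.coeHom (𝕜 := ℂ) (A := E)) a b).symm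

lemma star_coe (a : E) : star (a : 𝓜(ℂ, E)) = ((star a : E) : 𝓜(ℂ, E)) :=
  (map_star (DoubleCentralizer.coeHom (𝕜 := ℂ) (A := E)) a).symm

lemma isometry_coe : Isometry fun a : E => (a : 𝓜(ℂ, E)) :=
  AddMonoidHomClass.isometry_of_norm (DoubleCentralizer.coeHom (𝕜 := ℂ) (A := E))
    norm_coe_multiplier

lemma Corona.mk_eq_zero_iff {m : 𝓜(ℂ, E)} : Corona.mk E m = 0 ↔ m ∈ canonicalIdeal E :=
  Ideal.Quotient.eq_zero_iff_mem

lemma multiplier_ext {m n : 𝓜(ℂ, E)} (h : ∀ a : E, m.fst a = n.fst a) : m = n := by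
  rw [← sub_eq_zero, ← norm_eq_zero, ← DoubleCentralizer.norm_fst, norm_eq_zero]
  ext a
  simp [h a]

lemma mul_coe_eq (m : 𝓜(ℂ, E)) (a : E) : m * (a : 𝓜(ℂ, E)) = (m.fst a : 𝓜(ℂ, E)) := by
  refine multiplier_ext fun y => ?_
  have h2 : ∀ c, c * (m.fst a * y - m.fst (a * y)) = 0 := by
    intro c
    rw [mul_sub, ← mul_assoc, ← m.central, ← m.central, mul_assoc, sub_self]
  have h3 := h2 (star (m.fst a * y - m.fst (a * y)))
  rw [CStarRing.star_mul_self_eq_zero_iff, sub_eq_zero] at h3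
  simpa using h3.symm

lemma norm_fst_apply_le (m : 𝓜(ℂ, E)) (a : E) : ‖m.fst a‖ ≤ ‖m‖ * ‖a‖ := by
  rw [← DoubleCentralizer.norm_fst]
  exact m.fst.le_opNorm a

/-- The multiplier algebra is complete for the strict topology: pointwise convergent sequences of
multipliers converge. -/
lemma exists_strict_limit {W : ℕ → 𝓜(ℂ, E)} (hl : ∀ a : E, CauchySeq fun n => (W n).fst a)
    (hr : ∀ a : E, CauchySeq fun n => (star (W n)).fst a) :
    ∃ w : 𝓜(ℂ, E), (∀ a, Tendsto (fun n => (W n).fst a) atTop (𝓝 (w.fst a))) ∧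
      ∀ a, Tendsto (fun n => (star (W n)).fst a) atTop (𝓝 ((star w).fst a)) := by
  choose f hf using fun a => cauchySeq_tendsto_of_complete (hl a)
  choose g hg using fun a => cauchySeq_tendsto_of_complete (hr a)
  have hg' : ∀ a, Tendsto (fun n => (W n).snd a) atTop (𝓝 (star (g (star a)))) := fun a => by
    simpa using (hg (star a)).star
  let L : E →L[ℂ] E := continuousLinearMapOfTendsto (fun n => (W n).fst) (tendsto_pi_nhds.2 hf)
  let R : E →L[ℂ] E := continuousLinearMapOfTendsto (fun n => (W n).snd) (tendsto_pi_nhds.2 hg')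
  have hL : ∀ a, L a = f a := fun a => rfl
  have hR : ∀ a, R a = star (g (star a)) := fun a => rfl
  refine ⟨⟨(L, R), fun x y => ?_⟩, fun a => hf a, fun a => ?_⟩
  · have h1 := (hg' x).mul_const y
    have h2 := (hf y).const_mul x
    simp only [(W _).central] at h1
    exact tendsto_nhds_unique h1 h2
  · rw [DoubleCentralizer.star_fst]
    change Tendsto _ _ (𝓝 (star (R (star a))))
    rw [hR, star_star, star_star]
    exact hg a

/-- For a bounded sequence, strict convergence need only be tested on an approximate unit: `a` is
close to `h j * a`, uniformly in `n` after applying `W n`. -/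
lemma fst_cauchySeq_of_approximateUnit {W : ℕ → 𝓜(ℂ, E)} {C : ℝ} (hW : ∀ n, ‖W n‖ ≤ C)
    {h : ℕ → E} (hh : ∀ a : E, Tendsto (fun n => h n * a) atTop (𝓝 a))
    (hc : ∀ j, CauchySeq fun n => W n * (h j : 𝓜(ℂ, E))) (a : E) :
    CauchySeq fun n => (W n).fst a := by
  have hC : 0 ≤ C := (norm_nonneg _).trans (hW 0)
  have h1 : ∀ j, CauchySeq fun n => (W n).fst (h j * a) := fun j => by
    obtain ⟨l, hl⟩ := cauchySeq_tendsto_of_complete (hc j)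
    have h2 := (hl.mul_const (a : 𝓜(ℂ, E))).cauchySeq
    have h3 : ∀ n, W n * (h j : 𝓜(ℂ, E)) * (a : 𝓜(ℂ, E)) = ((W n).fst (h j * a) : 𝓜(ℂ, E)) :=
      fun n => by rw [mul_assoc, coe_mul_coe, mul_coe_eq]
    simp only [h3] at h2
    rw [Metric.cauchySeq_iff] at h2 ⊢
    simpa only [isometry_coe.dist_eq] using h2
  rw [Metric.cauchySeq_iff']
  intro ε hε
  have h3 : Tendsto (fun j => C * ‖h j * a - a‖) atTop (𝓝 0) := by
    simpa using ((hh a).sub_const a).norm.const_mul C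
  obtain ⟨j, hj⟩ := (h3.eventually (gt_mem_nhds (show 0 < ε / 3 by positivity))).exists
  obtain ⟨N, hN⟩ := Metric.cauchySeq_iff'.1 (h1 j) (ε / 3) (by positivity)
  refine ⟨N, fun n hn => ?_⟩
  have key : ∀ n, dist ((W n).fst a) ((W n).fst (h j * a)) < ε / 3 := fun n => by
    rw [dist_comm, dist_eq_norm, ← map_sub]
    exact ((norm_fst_apply_le _ _).trans
      (mul_le_mul_of_nonneg_right (hW n) (norm_nonneg _))).trans_lt hj
  have k1 := key n
  have k2 := key N
  have k3 := hN n hn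
  rw [dist_comm] at k2
  have := dist_triangle4 ((W n).fst a) ((W n).fst (h j * a)) ((W N).fst (h j * a)) ((W N).fst a)
  linarith

lemma strict_tendsto_mul {V W : ℕ → 𝓜(ℂ, E)} {v w : 𝓜(ℂ, E)} {C : ℝ} (hV : ∀ n, ‖V n‖ ≤ C)
    (hv : ∀ a, Tendsto (fun n => (V n).fst a) atTop (𝓝 (v.fst a)))
    (hw : ∀ a, Tendsto (fun n => (W n).fst a) atTop (𝓝 (w.fst a))) (a : E) :
    Tendsto (fun n => (V n * W n).fst a) atTop (𝓝 ((v * w).fst a)) := by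
  have h1 : ∀ n, (V n * W n).fst a = (V n).fst ((W n).fst a - w.fst a) + (V n).fst (w.fst a) :=
    fun n => by rw [← map_add, sub_add_cancel]; simp
  have h2 : Tendsto (fun n => (V n).fst ((W n).fst a - w.fst a)) atTop (𝓝 0) := by
    have h3 : Tendsto (fun n => C * ‖(W n).fst a - w.fst a‖) atTop (𝓝 0) := by
      simpa using ((hw a).sub_const (w.fst a)).norm.const_mul C
    exact squeeze_zero_norm (fun n => (norm_fst_apply_le _ _).trans
      (mul_le_mul_of_nonneg_right (hV n) (norm_nonneg _))) h3
  simp only [h1]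
  simpa using h2.add (hv (w.fst a))

/-- If the norm Cauchy sequence `T` converges strictly to `T'` and its image in the corona tends to
zero, then `T'` lies in the canonical ideal. -/
lemma mem_canonicalIdeal_of_strict_limit {T : ℕ → 𝓜(ℂ, E)} {T' : 𝓜(ℂ, E)} (hT : CauchySeq T)
    (h0 : Tendsto (fun n => Corona.mk E (T n)) atTop (𝓝 0))
    (hs : ∀ a, Tendsto (fun n => (T n).fst a) atTop (𝓝 (T'.fst a))) :
    T' ∈ canonicalIdeal E := by
  obtain ⟨l, hl⟩ := cauchySeq_tendsto_of_complete hT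
  have hlT : l = T' := multiplier_ext fun a => by
    refine tendsto_nhds_unique ?_ (hs a)
    rw [tendsto_iff_norm_sub_tendsto_zero] at hl ⊢
    refine squeeze_zero (fun _ => norm_nonneg _) (fun n => ?_) (by simpa using hl.mul_const ‖a‖)
    simpa using norm_fst_apply_le (T n - l) a
  rw [← hlT, ← Corona.mk_eq_zero_iff]
  have hcont : Continuous (Corona.mk E) :=
    AddMonoidHomClass.continuous_of_bound (Corona.mk E) 1 fun m => by
      simpa using Corona.norm_mk_le m
  exact tendsto_nhds_unique ((hcont.tendsto l).comp hl) h0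

end Multiplier

/-! ### Exact intertwining by a single unitary. -/

section Main

variable {E : Type*} [NonUnitalCStarAlgebra E]

lemma exists_isQuasicentralPair_canonicalIdeal {h : ℕ → E} (hsa : ∀ n, star (h n) = h n)
    (hn : ∀ n, ‖h n‖ ≤ 1) (hl : ∀ a : E, Tendsto (fun n => h n * a) atTop (𝓝 a))
    (hr : ∀ a : E, Tendsto (fun n => a * h n) atTop (𝓝 a)) (F : Set 𝓜(ℂ, E)) (hF : F.Finite)
    (ε : ℝ) (hε : 0 < ε) : ∃ c s, IsQuasicentralPair (canonicalIdeal E) F ε c s := by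
  refine exists_isQuasicentralPair (canonicalIdeal E) (fun n => (h n : 𝓜(ℂ, E)))
    (fun n => ⟨h n, rfl⟩) (fun n => ?_) (fun n => ?_) ?_ ?_ hF hε
  · rw [IsSelfAdjoint, star_coe, hsa]
  · rw [norm_coe_multiplier]; exact hn n
  · rintro _ ⟨a, rfl⟩
    simp only [coe_mul_coe]
    exact (isometry_coe.continuous.tendsto a).comp (hl a)
  · rintro _ ⟨a, rfl⟩
    simp only [coe_mul_coe]
    exact (isometry_coe.continuous.tendsto a).comp (hr a)

lemma norm_unitary_le_one {Q : Type*} [CStarAlgebra Q] (u : unitary Q) : ‖(u : Q)‖ ≤ 1 := by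
  rcases subsingleton_or_nontrivial Q with hQ | hQ
  · simp [Subsingleton.elim (u : Q) 0]
  · exact (CStarRing.norm_coe_unitary u).le

/-- The left side factors as `(v - u) * (star u - star v)`; bounding the second factor by `2` is
enough. -/
lemma norm_unitary_mul_star_add_le {Q : Type*} [CStarAlgebra Q] (u v : unitary Q) :
    ‖(u : Q) * star (v : Q) + v * star (u : Q) - 2‖ ≤ 2 * ‖(v : Q) - u‖ := by
  have h1 : (u : Q) * star (v : Q) + v * star (u : Q) - 2
      = ((v : Q) - u) * (star (u : Q) - star (v : Q)) := by
    have hu : (u : Q) * star (u : Q) = 1 := Unitary.coe_mul_star_self u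
    have hv : (v : Q) * star (v : Q) = 1 := Unitary.coe_mul_star_self v
    rw [sub_mul, mul_sub, mul_sub, hu, hv, ← one_add_one_eq_two]
    abel
  have h2 : ‖star (u : Q) - star (v : Q)‖ ≤ 2 := by
    rw [← star_sub, norm_star]
    exact (norm_sub_le _ _).trans (by linarith [norm_unitary_le_one u, norm_unitary_le_one v])
  rw [h1, mul_comm 2]
  exact norm_mul_le_of_le le_rfl h2

lemma star_interpolate {A : Type*} [CStarAlgebra A] {J : Ideal A} {F : Set A} {ε : ℝ} {c s : A}
    (h : IsQuasicentralPair J F ε c s) (W U : A) :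
    star (c * W * c + s * U * s) = c * star W * c + s * star U * s := by
  simp only [star_add, star_mul, h.isSelfAdjoint_left.star_eq, h.isSelfAdjoint_right.star_eq,
    mul_assoc]

lemma exists_corona_lift (x : Corona E) (n : ℕ) :
    ∃ m : 𝓜(ℂ, E), Corona.mk E m = x ∧ ‖m‖ ≤ ‖x‖ + (1 / 2) ^ n := by
  obtain ⟨m, hm, hmn⟩ := Corona.exists_norm_lt x (show (0 : ℝ) < (1 / 2) ^ n by positivity)
  exact ⟨m, hm, hmn.le⟩

lemma tendsto_lift_norm {x : ℕ → Corona E} (hx : Tendsto (fun n => ‖x n‖) atTop (𝓝 0))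
    {m : ℕ → 𝓜(ℂ, E)} (hm : ∀ n, ‖m n‖ ≤ ‖x n‖ + (1 / 2) ^ n) :
    Tendsto (fun n => ‖m n‖) atTop (𝓝 0) := by
  refine squeeze_zero (fun _ => norm_nonneg _) hm ?_
  simpa using hx.add (tendsto_pow_atTop_nhds_zero_of_lt_one (by norm_num : (0 : ℝ) ≤ 1 / 2)
    (by norm_num))

set_option maxHeartbeats 1600000 in
/-- Asymptotic intertwining of two sequences in the corona along a slowly varying sequence of
unitaries can be implemented exactly by one unitary. -/
theorem exists_unitary_intertwiner (hσ : IsSigmaUnital E) {u : ℕ → unitary (Corona E)}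
    (hu : Tendsto (fun n => ‖(u (n + 1) : Corona E) - u n‖) atTop (𝓝 0)) {x y : ℕ → Corona E}
    (hxy : ∀ j, Tendsto (fun n => ‖(u n : Corona E) * x j - y j * (u n : Corona E)‖) atTop (𝓝 0)) :
    ∃ w : unitary (Corona E), ∀ j, (w : Corona E) * x j = y j * w := by
  obtain ⟨h, hpos, hh⟩ := hσ
  have hsa : ∀ n, star (h n) = h n := fun n => by
    obtain ⟨b, hb⟩ := (hpos n).1
    rw [hb, star_mul, star_star]
  have hh1 : ∀ n, ‖h n‖ ≤ 1 := fun n => (hpos n).2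
  have hq := exists_isQuasicentralPair_canonicalIdeal hsa hh1 (fun a => (hh a).1)
    (fun a => (hh a).2)
  -- Index `0` gives the uniform bound `1 + (1 / 2) ^ 0 = 2`; the error lifts below use index `n` so
  -- that their norms tend to zero.
  choose U hU hUn using fun n => exists_corona_lift (u n : Corona E) 0
  have hU2 : ∀ n, ‖U n‖ ≤ 2 := fun n => (hUn n).trans (by
    linarith [norm_unitary_le_one (u n)])
  have hU2' : ∀ n, ‖star (U n)‖ ≤ 2 := fun n => (norm_star _).trans_le (hU2 n)
  choose X hX using fun j => Corona.mk_surjective (x j)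
  choose Y hY using fun j => Corona.mk_surjective (y j)
  choose b hb hbn using fun j n =>
    exists_corona_lift ((u n : Corona E) * x j - y j * (u n : Corona E)) n
  choose r hr hrn using fun n => exists_corona_lift
    ((u n : Corona E) * star (u (n + 1) : Corona E) + (u (n + 1) : Corona E) * star (u n : Corona E)
      - 2) n
  choose r' hr' hrn' using fun n => exists_corona_lift
    (star (u n : Corona E) * (u (n + 1) : Corona E) + star (u (n + 1) : Corona E) * (u n : Corona E)
      - 2) n
  have hb0 : ∀ j, Tendsto (fun n => ‖b j n‖) atTop (𝓝 0) := fun j =>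
    tendsto_lift_norm (hxy j) (hbn j)
  have hr0 : Tendsto (fun n => ‖r n‖) atTop (𝓝 0) := by
    refine tendsto_lift_norm (squeeze_zero (fun _ => norm_nonneg _)
      (fun n => norm_unitary_mul_star_add_le (u n) (u (n + 1))) ?_) hrn
    simpa using hu.const_mul 2
  have hr0' : Tendsto (fun n => ‖r' n‖) atTop (𝓝 0) := by
    refine tendsto_lift_norm (squeeze_zero (fun _ => norm_nonneg _) (fun n => ?_)
      (by simpa using hu.const_mul 2)) hrn'
    have h1 := norm_unitary_mul_star_add_le (star (u n)) (star (u (n + 1)))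
    simp only [Unitary.coe_star, star_star] at h1
    refine h1.trans_eq ?_
    rw [← star_sub, norm_star]
  -- These are the elements to which the gluing estimates are applied. Including the defects of `W`
  -- at stage `n` lets every later stage be compared with them; restricting to `j ≤ n` keeps the set
  -- finite.
  let ext (n : ℕ) (W : 𝓜(ℂ, E)) : Set 𝓜(ℂ, E) :=
    {W, star W, U (n + 1), star (U (n + 1)), W * star W - 1, star W * W - 1,
      U (n + 1) * star (U (n + 1)) - 1, star (U (n + 1)) * U (n + 1) - 1,
      W * star (U (n + 1)) + U (n + 1) * star W - 2 - r n,
      star W * U (n + 1) + star (U (n + 1)) * W - 2 - r' n} ∪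
    ⋃ j ∈ Set.Iic n, {(h j : 𝓜(ℂ, E)), X j, Y j, W * X j - Y j * W, W * X j - Y j * W - b j n,
      U (n + 1) * X j - Y j * U (n + 1) - b j (n + 1)}
  have hext : ∀ n W, (ext n W).Finite := fun n W =>
    (Set.toFinite _).union ((Set.finite_Iic n).biUnion fun _ _ => Set.toFinite _)
  obtain ⟨W, c, s, hW0, hWs, hcs⟩ := exists_interpolating_seq hq U ext hext
  have hmemF : ∀ {k n a}, k ≤ n → a ∈ ext k (W k) → a ∈ ⋃ k ≤ n, ext k (W k) :=
    fun hk ha => Set.mem_iUnion₂_of_mem hk ha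
  have hmk : ∀ n, Corona.mk E (W n) = u n := by
    intro n
    induction n with
    | zero => rw [hW0, hU]
    | succ n ih =>
      have h1 := Corona.mk_eq_zero_iff.2 (hcs n).mem
      have h2 := Corona.mk_eq_zero_iff.2 (hcs n).one_sub_mem
      rw [map_sub, map_one, sub_eq_zero] at h2
      rw [hWs, map_add, map_mul, map_mul, map_mul, map_mul, h1, ← h2, hU]
      simp
  have hW2 : ∀ n, ‖W n‖ ≤ 2 := by
    intro n
    induction n with
    | zero => rw [hW0]; exact hU2 0
    | succ n ih =>
      rw [hWs]
      exact ((hcs n).norm_add_le_max _ _).trans (max_le ih (hU2 _))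
  have hW2' : ∀ n, ‖star (W n)‖ ≤ 2 := fun n => (norm_star _).trans_le (hW2 n)
  have hWs' : ∀ n, star (W (n + 1)) = c n * star (W n) * c n + s n * star (U (n + 1)) * s n :=
    fun n => by rw [hWs, star_interpolate (hcs n)]
  have hhJ : ∀ j, (h j : 𝓜(ℂ, E)) ∈ canonicalIdeal E := fun j => ⟨h j, rfl⟩
  have hhn : ∀ j, ‖(h j : 𝓜(ℂ, E))‖ ≤ 1 := fun j => (norm_coe_multiplier _).trans_le (hh1 j)
  have hmk2 : Corona.mk E 2 = 2 := map_ofNat (Corona.mk E) 2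
  have cauchyW : ∀ j, CauchySeq fun n => W n * (h j : 𝓜(ℂ, E)) := by
    intro j
    refine cauchySeq_of_norm_step (β := fun _ => 0) (C := 5) (by norm_num) j tendsto_const_nhds
      fun n k hn hk => ?_
    have step := (hcs k).norm_interpolate_mul_sub (hU2 (k + 1)) (hmemF le_rfl (Or.inl (by simp)))
      (hmemF (hn.trans hk) (Or.inr (Set.mem_biUnion (Set.mem_Iic.2 le_rfl) (by simp))))
      (hhJ j) (hhn j) (hW2 k)
    rw [hWs, ← sub_add_sub_cancel _ (W k * (h j : 𝓜(ℂ, E)))]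
    refine (norm_add_le_of_le step le_rfl).trans ?_
    rw [add_comm]
    exact add_le_add_left (le_max_left _ _) _
  have cauchyW' : ∀ j, CauchySeq fun n => star (W n) * (h j : 𝓜(ℂ, E)) := by
    intro j
    refine cauchySeq_of_norm_step (β := fun _ => 0) (C := 5) (by norm_num) j tendsto_const_nhds
      fun n k hn hk => ?_
    have step := (hcs k).norm_interpolate_mul_sub (hU2' (k + 1)) (hmemF le_rfl (Or.inl (by simp)))
      (hmemF (hn.trans hk) (Or.inr (Set.mem_biUnion (Set.mem_Iic.2 le_rfl) (by simp))))
      (hhJ j) (hhn j) (hW2' k)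
    rw [hWs', ← sub_add_sub_cancel _ (star (W k) * (h j : 𝓜(ℂ, E)))]
    refine (norm_add_le_of_le step le_rfl).trans ?_
    rw [add_comm]
    exact add_le_add_left (le_max_left _ _) _
  have cauchyD : ∀ j, CauchySeq fun n => W n * X j - Y j * W n := by
    intro j
    -- The step from `k` to `k + 1` involves `b j (k + 1)`, hence the shifted summand in `β`.
    refine cauchySeq_of_norm_step (β := fun n => ‖b j n‖ + ‖b j (n + 1)‖) (C := 12) (by norm_num) j
      (by simpa using (hb0 j).add ((hb0 j).comp (tendsto_add_atTop_nat 1))) fun n k hn hk => ?_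
    have hjk := hn.trans hk
    have mem1 : ∀ {a}, a ∈ ({(h j : 𝓜(ℂ, E)), X j, Y j, W n * X j - Y j * W n,
        W n * X j - Y j * W n - b j n, U (n + 1) * X j - Y j * U (n + 1) - b j (n + 1)} : Set _) →
        a ∈ ⋃ k' ≤ k, ext k' (W k') :=
      fun ha => hmemF hk (Or.inr (Set.mem_biUnion (Set.mem_Iic.2 hn) ha))
    have mem2 : U (k + 1) * X j - Y j * U (k + 1) - b j (k + 1) ∈ ⋃ k' ≤ k, ext k' (W k') :=
      hmemF le_rfl (Or.inr (Set.mem_biUnion (Set.mem_Iic.2 hjk) (by simp)))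
    have step := (hcs k).norm_interpolate_intertwine_sub (D := W n * X j - Y j * W n) (b := b j n)
      (X := X j) (Y := Y j) (hW2 k) (hU2 (k + 1)) (mem1 (by simp)) (mem1 (by simp))
      (mem1 (by simp)) (mem1 (by simp))
      (Corona.mk_eq_zero_iff.1 (by simp only [map_sub, map_mul, hmk, hX, hY, hb, sub_self]))
      mem2 (Corona.mk_eq_zero_iff.1 (by simp only [map_sub, map_mul, hU, hX, hY, hb, sub_self]))
    rw [hWs]
    refine step.trans (add_le_add_left (max_le_max le_rfl ((norm_sub_le _ _).trans ?_)) _)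
    linarith [norm_nonneg (b j k), norm_nonneg (b j (n + 1))]
  have cauchyP : CauchySeq fun n => W n * star (W n) - 1 := by
    refine cauchySeq_of_norm_step (β := fun n => ‖r n‖) (C := 20) (by norm_num) 0 hr0
      fun n k _ hk => ?_
    have step := (hcs k).norm_interpolate_product_sub (P := W n * star (W n) - 1) (r := r k)
      (hW2 k) (hW2' k) (hU2 (k + 1)) (hU2' (k + 1))
      (hmemF le_rfl (Or.inl (by simp))) (hmemF le_rfl (Or.inl (by simp)))
      (hmemF le_rfl (Or.inl (by simp))) (hmemF le_rfl (Or.inl (by simp)))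
      (hmemF hk (Or.inl (by simp)))
      (Corona.mk_eq_zero_iff.1 (by simp [← Corona.star_mk, hmk]))
      (hmemF le_rfl (Or.inl (by simp)))
      (Corona.mk_eq_zero_iff.1 (by simp [← Corona.star_mk, hmk, hU, hr, hmk2]))
      (hmemF le_rfl (Or.inl (by simp)))
      (Corona.mk_eq_zero_iff.1 (by simp [← Corona.star_mk, hU]))
    rw [hWs', hWs]
    exact step.trans (add_le_add_left (max_le_max le_rfl (by linarith [norm_nonneg (r n)])) _)
  have cauchyP' : CauchySeq fun n => star (W n) * W n - 1 := by
    refine cauchySeq_of_norm_step (β := fun n => ‖r' n‖) (C := 20) (by norm_num) 0 hr0'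
      fun n k _ hk => ?_
    have step := (hcs k).norm_interpolate_product_sub (P := star (W n) * W n - 1) (r := r' k)
      (hW2' k) (hW2 k) (hU2' (k + 1)) (hU2 (k + 1))
      (hmemF le_rfl (Or.inl (by simp))) (hmemF le_rfl (Or.inl (by simp)))
      (hmemF le_rfl (Or.inl (by simp))) (hmemF le_rfl (Or.inl (by simp)))
      (hmemF hk (Or.inl (by simp)))
      (Corona.mk_eq_zero_iff.1 (by simp [← Corona.star_mk, hmk]))
      (hmemF le_rfl (Or.inl (by simp)))
      (Corona.mk_eq_zero_iff.1 (by simp [← Corona.star_mk, hmk, hU, hr', hmk2]))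
      (hmemF le_rfl (Or.inl (by simp)))
      (Corona.mk_eq_zero_iff.1 (by simp [← Corona.star_mk, hU]))
    rw [hWs', hWs]
    exact step.trans (add_le_add_left (max_le_max le_rfl (by linarith [norm_nonneg (r' n)])) _)
  obtain ⟨w, hw, hw'⟩ := exists_strict_limit
    (fst_cauchySeq_of_approximateUnit hW2 (fun a => (hh a).1) cauchyW)
    (fst_cauchySeq_of_approximateUnit hW2' (fun a => (hh a).1) cauchyW')
  -- Multiplication is strictly continuous on bounded sequences, so the strict limit of the defects
  -- is the defect of `w`.
  have hww : w * star w - 1 ∈ canonicalIdeal E := by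
    refine mem_canonicalIdeal_of_strict_limit cauchyP
      (by simp [← Corona.star_mk, hmk]) fun a => ?_
    simpa using (strict_tendsto_mul hW2 hw hw' a).sub_const a
  have hww' : star w * w - 1 ∈ canonicalIdeal E := by
    refine mem_canonicalIdeal_of_strict_limit cauchyP'
      (by simp [← Corona.star_mk, hmk]) fun a => ?_
    simpa using (strict_tendsto_mul hW2' hw' hw a).sub_const a
  have hwxy : ∀ j, w * X j - Y j * w ∈ canonicalIdeal E := by
    intro j
    refine mem_canonicalIdeal_of_strict_limit (cauchyD j) ?_ fun a => ?_
    · simp only [map_sub, map_mul, hmk, hX, hY]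
      exact tendsto_zero_iff_norm_tendsto_zero.2 (hxy j)
    · simpa using (hw ((X j).fst a)).sub (((Y j).fst.continuous.tendsto _).comp (hw a))
  refine ⟨⟨Corona.mk E w, Unitary.mem_iff.2 ⟨?_, ?_⟩⟩, fun j => ?_⟩
  · have := Corona.mk_eq_zero_iff.2 hww'
    rwa [map_sub, map_mul, map_one, ← Corona.star_mk, sub_eq_zero] at this
  · have := Corona.mk_eq_zero_iff.2 hww
    rwa [map_sub, map_mul, map_one, ← Corona.star_mk, sub_eq_zero] at this
  · have := Corona.mk_eq_zero_iff.2 (hwxy j)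
    rwa [map_sub, map_mul, map_mul, hX, hY, sub_eq_zero] at this

lemma Extension.continuous {D : Type*} [NonUnitalCStarAlgebra D] (φ : Extension D E) :
    Continuous φ :=
  AddMonoidHomClass.continuous_of_bound φ 1 fun a => by
    simpa only [one_mul] using NonUnitalStarAlgHom.norm_apply_le φ a

end Main

end CStarExt

theorem mainTheorem10 {D E : Type*} [NonUnitalCStarAlgebra D] [NonUnitalCStarAlgebra E]
    (hD : TopologicalSpace.SeparableSpace D) (hE : CStarExt.IsNonunital E)
    (hσ : CStarExt.IsSigmaUnital E) (φ ψ : CStarExt.Extension D E) :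
    CStarExt.AsymptoticallyUnitarilyEquivalent φ ψ ↔
      CStarExt.WeaklyUnitarilyEquivalent φ ψ := by
  constructor
  · rintro ⟨u, hu, hconv⟩
    obtain ⟨t, ht, htu⟩ := CStarExt.exists_seq_tendsto_dist_succ hu
    obtain ⟨w, hw⟩ := CStarExt.exists_unitary_intertwiner hσ (u := fun n => u (t n))
      (x := fun j => φ (TopologicalSpace.denseSeq D j))
      (y := fun j => ψ (TopologicalSpace.denseSeq D j))
      (by simpa only [Subtype.dist_eq, dist_eq_norm] using htu) (fun j => by
        have h1 := (((hconv (TopologicalSpace.denseSeq D j)).comp ht).sub_const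
          (ψ (TopologicalSpace.denseSeq D j))).norm
        rw [sub_self, norm_zero] at h1
        refine h1.congr fun n => ?_
        -- Right multiplication by `u (t n)` preserves the norm and turns `u φ u* - ψ` into `u φ - ψ
        -- u`.
        rw [← CStarRing.norm_mul_coe_unitary _ (u (t n)), sub_mul]
        simp only [Function.comp_apply, mul_assoc, Unitary.coe_star_mul_self, mul_one])
    refine ⟨w, fun a => ?_⟩
    have h1 : ∀ a, (w : CStarExt.Corona E) * φ a = ψ a * w := fun a => congrFun
      ((TopologicalSpace.denseRange_denseSeq D).equalizer
        (continuous_const.mul (CStarExt.Extension.continuous φ))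
        ((CStarExt.Extension.continuous ψ).mul continuous_const) (funext hw)) a
    have h2 : (w : CStarExt.Corona E) * star (w : CStarExt.Corona E) = 1 :=
      Unitary.coe_mul_star_self w
    rw [h1, mul_assoc, h2, mul_one]
  · rintro ⟨w, hw⟩
    exact ⟨fun _ => w, continuous_const, fun a => by simp only [hw]; exact tendsto_const_nhds⟩
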